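/- For an integer $n\ge 2$ and $c\in\mathbb C$ let $P_{n,c}(z)=z^n+c$. Let $K(P_{n,c})$ be the filled Julia set, that is, the set of all $z\in\mathbb C$ whose forward orbit under $P_{n,c}$ is bounded, and let the Julia set $J(P_{n,c})=\partial K(P_{n,c})$ be its boundary in $\mathbb C$. Let $\theta\in\mathbb R$ and $c=e^{2\pi i\theta}$. Then for every $\epsilon>0$ there is an $N\ge 2$ such that for every integer $n\ge N$ the following hold: 1. if $\cos(2\pi\theta(n-1))<-\frac12-\frac{\epsilon}{2}$, then $K(P_{n,c})$ is connected; 2. if $\cos(2\pi\theta(n-1))>-\frac12+\frac{\epsilon}{2}$, then $K(P_{n,c})$ is totally disconnected and $K(P_{n,c})=J(P_{n,c})$. -/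

import Mathlib

/-- The unicritical polynomial `P_{n,c}(z) = z ^ n + c` on the complex plane. -/
def unicriticalMap (n : ℕ) (c : ℂ) (z : ℂ) : ℂ := z ^ n + c

/-- The filled Julia set of `f : ℂ → ℂ`: the points whose forward orbit
`z, f z, f (f z), …` is bounded. -/
def filledJuliaSet (f : ℂ → ℂ) : Set ℂ :=
  {z | Bornology.IsBounded (Set.range fun k : ℕ => f^[k] z)}

/-- The Julia set of `f : ℂ → ℂ` (used for polynomials): the topological boundary in `ℂ` of the
filled Julia set. -/
def juliaSet (f : ℂ → ℂ) : Set ℂ := frontier (filledJuliaSet f)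

/-! The second iterate of the critical point 0 is `c ^ n + c`, and its squared modulus is 2 +
2cos(2πθ(n-1)). The cosine hypotheses thus place it inside or outside the unit circle by a margin
independent of n, while for large n the map escapes outside radius `R = 1 + η`, so the filled Julia
set is the decreasing intersection of the level sets. Inside: `norm_map_map_sub_le` makes two steps
send the disc of radius 1 - 3η into itself, so the critical orbit stays bounded. Each level set is
then connected, since pulling back preserves connectedness when the critical value, whose fibre is a
single point, is included. Outside: the critical value leaves the disc, so inverse branches exist
near the first level set (`exists_iterate_inverse_branch`). By `expansion` they contract
geometrically, so connected subsets are points. -/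

/-! ### Connectedness of intersections and preimages -/

open Filter Topology in
/-- The intersection of a decreasing sequence of compact connected sets is preconnected. -/
theorem isPreconnected_iInter_of_antitone_isCompact {X : Type*} [TopologicalSpace X] [T2Space X]
    {A : ℕ → Set X} (hA : Antitone A) (hc : ∀ k, IsCompact (A k))
    (hp : ∀ k, IsPreconnected (A k)) : IsPreconnected (⋂ k, A k) := by
  have hK : IsCompact (⋂ k, A k) :=
    (hc 0).of_isClosed_subset (isClosed_iInter fun k => (hc k).isClosed) (Set.iInter_subset _ 0)
  rw [isPreconnected_iff_subset_of_fully_disjoint_closed hK.isClosed]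
  intro u v hu hv huv hd
  obtain ⟨U, V, hU, hV, huU, hvV, hUV⟩ :=
    (SeparatedNhds.of_isCompact_isCompact (hK.inter_right hu) (hK.inter_right hv)
      (hd.mono Set.inter_subset_right Set.inter_subset_right))
  have hsub : (⋂ k, A k) ⊆ U ∪ V := fun x hx =>
    (huv hx).imp (fun h => huU ⟨hx, h⟩) (fun h => hvV ⟨hx, h⟩)
  obtain ⟨k, hk⟩ := exists_subset_nhds_of_isCompact' (hA.directed_ge) hc
    (fun k => (hc k).isClosed) (fun x hx => (hU.union hV).mem_nhds (hsub hx))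
  have key := (isPreconnected_iff_subset_of_disjoint.1 (hp k)) U V hU hV hk
    (by rw [hUV.inter_eq, Set.inter_empty])
  refine key.imp (fun h x hx => ?_) (fun h x hx => ?_)
  · refine (huv hx).resolve_right fun hxv => ?_
    exact Set.disjoint_left.1 hUV (h (Set.mem_iInter.1 hx k)) (hvV ⟨hx, hxv⟩)
  · refine (huv hx).resolve_left fun hxu => ?_
    exact Set.disjoint_left.1 hUV (huU ⟨hx, hxu⟩) (h (Set.mem_iInter.1 hx k))

/-- Under an open and closed map, the preimage of a preconnected set containing a point with
exactly one preimage is preconnected. -/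
theorem IsPreconnected.preimage_of_subsingleton_fiber {X Y : Type*} [TopologicalSpace X]
    [TopologicalSpace Y] {p : X → Y} (ho : IsOpenMap p) (hcl : IsClosedMap p) {A : Set Y}
    (hA : IsPreconnected A) {x₀ : X} (hx₀ : p x₀ ∈ A) (hf : ∀ x, p x = p x₀ → x = x₀) :
    IsPreconnected (p ⁻¹' A) := by
  rw [isPreconnected_iff_subset_of_disjoint]
  have hmain : ∀ u v : Set X, IsOpen u → IsOpen v → p ⁻¹' A ⊆ u ∪ v →
      p ⁻¹' A ∩ (u ∩ v) = ∅ → x₀ ∈ u → p ⁻¹' A ⊆ u := by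
    intro u v hu hv huv hd h0 x hx
    by_contra hxu
    have hxv : x ∈ v := (huv hx).resolve_left hxu
    -- The two open sets consist of the points whose fibre meets `v` and those whose fibre lies in
    -- `u`; the one-point fibre puts `p x₀` in the second.
    have hAsub : A ⊆ p '' v ∪ (p '' uᶜ)ᶜ := by
      intro y _
      by_cases hy : y ∈ p '' v
      · exact Or.inl hy
      · refine Or.inr ?_
        rintro ⟨z, hz, rfl⟩
        exact hy ⟨z, (huv (show z ∈ p ⁻¹' A by assumption)).resolve_left hz, rfl⟩
    obtain ⟨y, hyA, ⟨z, hz, rfl⟩, hzu⟩ := hA _ _ (ho v hv) (hcl _ hu.isClosed_compl).isOpen_compl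
      hAsub ⟨p x, hx, x, hxv, rfl⟩ ⟨p x₀, hx₀, by
        rintro ⟨z, hz, hzx⟩
        exact hz (hf z hzx ▸ h0)⟩
    have hzu' : z ∈ u := by
      by_contra h
      exact hzu ⟨z, h, rfl⟩
    exact Set.notMem_empty z (hd ▸ ⟨hyA, hzu', hz⟩)
  intro u v hu hv huv hd
  rcases huv hx₀ with h | h
  · exact Or.inl (hmain u v hu hv huv hd h)
  · exact Or.inr (hmain v u hv hu (by rwa [Set.union_comm]) (by rwa [Set.inter_comm v u]) h)

theorem norm_add_pow_sub_pow_le {c δ : ℂ} (hc : ‖c‖ = 1) (n : ℕ) :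
    ‖(δ + c) ^ n - c ^ n‖ ≤ (1 + ‖δ‖) ^ n - 1 := by
  induction n with
  | zero => simp
  | succ n ih =>
    have h1 : (δ + c) ^ (n + 1) - c ^ (n + 1) = (δ + c) * ((δ + c) ^ n - c ^ n) + δ * c ^ n := by
      ring
    have h2 : ‖δ + c‖ ≤ 1 + ‖δ‖ := by
      have := norm_add_le δ c
      rw [hc] at this
      linarith
    calc ‖(δ + c) ^ (n + 1) - c ^ (n + 1)‖
        ≤ ‖δ + c‖ * ‖(δ + c) ^ n - c ^ n‖ + ‖δ‖ := by
          rw [h1]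
          refine (norm_add_le _ _).trans (le_of_eq ?_)
          rw [norm_mul, norm_mul, norm_pow, hc, one_pow, mul_one]
      _ ≤ (1 + ‖δ‖) * ((1 + ‖δ‖) ^ n - 1) + ‖δ‖ := by gcongr
      _ = (1 + ‖δ‖) ^ (n + 1) - 1 := by ring

/-! ### Escape radius and level sets -/

namespace unicriticalMap

variable {n : ℕ} {c : ℂ} {R : ℝ}

theorem continuous_iterate (k : ℕ) : Continuous (unicriticalMap n c)^[k] := by
  refine Continuous.iterate ?_ k
  unfold unicriticalMap
  fun_prop

/-- The points whose `k`-th iterate lies in the closed disc of radius `R`. -/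
def levelSet (n : ℕ) (c : ℂ) (R : ℝ) (k : ℕ) : Set ℂ :=
  (unicriticalMap n c)^[k] ⁻¹' Metric.closedBall 0 R

theorem mem_levelSet {k : ℕ} {z : ℂ} :
    z ∈ levelSet n c R k ↔ ‖(unicriticalMap n c)^[k] z‖ ≤ R := by
  simp [levelSet]

theorem two_mul_norm_le (hc : ‖c‖ = 1) (hR : 1 < R) (h3 : 3 ≤ R ^ (n - 1)) (hn : n ≠ 0) {z : ℂ}
    (hz : R < ‖z‖) : 2 * ‖z‖ ≤ ‖unicriticalMap n c z‖ := by
  have h1 : ‖z ^ n‖ - ‖c‖ ≤ ‖unicriticalMap n c z‖ := by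
    have := norm_sub_norm_le (z ^ n) (-c)
    simpa [unicriticalMap] using this
  have h2 : ‖z ^ n‖ = ‖z‖ ^ (n - 1) * ‖z‖ := by
    rw [norm_pow, ← pow_succ, Nat.sub_add_cancel (Nat.one_le_iff_ne_zero.2 hn)]
  have h4 : R ^ (n - 1) ≤ ‖z‖ ^ (n - 1) := by gcongr
  have h5 : 3 * ‖z‖ ≤ ‖z‖ ^ (n - 1) * ‖z‖ := by gcongr; linarith
  rw [hc, h2] at h1
  linarith

theorem levelSet_antitone (hc : ‖c‖ = 1) (hR : 1 < R) (h3 : 3 ≤ R ^ (n - 1)) (hn : n ≠ 0) :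
    Antitone (levelSet n c R) := by
  refine antitone_nat_of_succ_le fun k z hz => ?_
  rw [mem_levelSet] at hz ⊢
  by_contra! h
  have := two_mul_norm_le hc hR h3 hn h
  rw [Function.iterate_succ_apply'] at hz
  linarith

theorem filledJuliaSet_eq (hc : ‖c‖ = 1) (hR : 1 < R) (h3 : 3 ≤ R ^ (n - 1)) (hn : n ≠ 0) :
    filledJuliaSet (unicriticalMap n c) = ⋂ k, levelSet n c R k := by
  ext z
  simp only [filledJuliaSet, Set.mem_ofPred_eq, Set.mem_iInter, mem_levelSet]
  constructor
  · intro hb k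
    by_contra! hk
    have hgrow : ∀ j : ℕ, 2 ^ j * R < ‖(unicriticalMap n c)^[k + j] z‖ := by
      intro j
      induction j with
      | zero => simpa using hk
      | succ j ih =>
        have h1 : R ≤ 2 ^ j * R := le_mul_of_one_le_left (by linarith) (one_le_pow₀ (by norm_num))
        have h2 := two_mul_norm_le hc hR h3 hn (h1.trans_lt ih)
        rw [← add_assoc, Function.iterate_succ_apply', pow_succ]
        linarith
    obtain ⟨M, hM⟩ := hb.exists_norm_le
    obtain ⟨j, hj⟩ := pow_unbounded_of_one_lt M (one_lt_two : (1 : ℝ) < 2)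
    have h1 := hM _ ⟨k + j, rfl⟩
    have h2 : (2 : ℝ) ^ j ≤ 2 ^ j * R := le_mul_of_one_le_right (by positivity) hR.le
    linarith [hgrow j]
  · intro h
    refine (Metric.isBounded_closedBall (x := (0 : ℂ)) (r := R)).subset ?_
    rintro _ ⟨k, rfl⟩
    simpa using h k

theorem isClosed_levelSet (k : ℕ) : IsClosed (levelSet n c R k) :=
  Metric.isClosed_closedBall.preimage (continuous_iterate k)

theorem isCompact_levelSet (hc : ‖c‖ = 1) (hR : 1 < R) (h3 : 3 ≤ R ^ (n - 1)) (hn : n ≠ 0)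
    (k : ℕ) : IsCompact (levelSet n c R k) :=
  (isCompact_closedBall (0 : ℂ) R).of_isClosed_subset (isClosed_levelSet k)
    (levelSet_antitone hc hR h3 hn (Nat.zero_le k))

theorem isOpenMap (hn : n ≠ 0) : IsOpenMap (unicriticalMap n c) := by
  have : NeZero n := ⟨hn⟩
  exact (Homeomorph.addRight c).isOpenMap.comp (Complex.isOpenQuotientMap_pow n).isOpenMap

theorem isClosedMap (hn : n ≠ 0) : IsClosedMap (unicriticalMap n c) := by
  have h : IsProperMap (unicriticalMap n c) := by
    rw [isProperMap_iff_tendsto_cocompact]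
    refine ⟨continuous_iterate 1, ?_⟩
    rw [← Metric.cobounded_eq_cocompact]
    have h1 : Filter.Tendsto (fun z : ℂ => ‖z‖ ^ n - ‖c‖) (Bornology.cobounded ℂ) Filter.atTop :=
      Filter.tendsto_atTop_add_const_right _ _
        ((Filter.tendsto_pow_atTop hn).comp tendsto_norm_cobounded_atTop)
    rw [← tendsto_norm_atTop_iff_cobounded]
    refine Filter.tendsto_atTop_mono (fun z => ?_) h1
    have := norm_sub_norm_le (z ^ n) (-c)
    simpa [unicriticalMap] using this
  exact h.isClosedMap

/-! ### Bounded critical orbit -/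

theorem isPreconnected_levelSet (hn : n ≠ 0)
    (h0 : ∀ k, (0 : ℂ) ∈ levelSet n c R k) (k : ℕ) : IsPreconnected (levelSet n c R k) := by
  induction k with
  | zero => exact (convex_closedBall (0 : ℂ) R).isPreconnected
  | succ k ih =>
    have h : levelSet n c R (k + 1) = unicriticalMap n c ⁻¹' levelSet n c R k := rfl
    rw [h]
    refine ih.preimage_of_subsingleton_fiber (isOpenMap hn) (isClosedMap hn)
      (x₀ := 0) (h0 (k + 1)) fun x hx => ?_
    simpa [unicriticalMap, hn] using hx

theorem isConnected_filledJuliaSet (hc : ‖c‖ = 1) (hR : 1 < R) (h3 : 3 ≤ R ^ (n - 1)) (hn : n ≠ 0)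
    (h0 : ∀ k, (0 : ℂ) ∈ levelSet n c R k) :
    IsConnected (filledJuliaSet (unicriticalMap n c)) := by
  rw [filledJuliaSet_eq hc hR h3 hn]
  exact ⟨⟨0, Set.mem_iInter.2 h0⟩, isPreconnected_iInter_of_antitone_isCompact
    (levelSet_antitone hc hR h3 hn) (isCompact_levelSet hc hR h3 hn)
    (isPreconnected_levelSet hn h0)⟩

/-! ### Inverse branches and total disconnectedness -/

/-- The image of `t * z` is a convex combination of the image of `z` and of `c`, both in the disc.
-/
theorem smul_mem_levelSet_one (hc : ‖c‖ = 1) (hR : 1 < R) {z : ℂ} (hz : z ∈ levelSet n c R 1)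
    {t : ℝ} (ht0 : 0 ≤ t) (ht1 : t ≤ 1) : (t : ℂ) * z ∈ levelSet n c R 1 := by
  rw [mem_levelSet, Function.iterate_one, unicriticalMap] at hz ⊢
  have hs0 : 0 ≤ t ^ n := by positivity
  have hs1 : t ^ n ≤ 1 := pow_le_one₀ ht0 ht1
  have h : ((t : ℂ) * z) ^ n + c = ((t ^ n : ℝ) : ℂ) * (z ^ n + c) + ((1 - t ^ n : ℝ) : ℂ) * c := by
    push_cast
    ring
  rw [h]
  refine (norm_add_le _ _).trans ?_
  rw [norm_mul, norm_mul, hc, Complex.norm_real, Complex.norm_real, Real.norm_of_nonneg hs0,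
    Real.norm_of_nonneg (by linarith)]
  nlinarith

/-- By star-shapedness, a point of the ray from `c` to infinity would bring `c` along. This makes
the principal n-th root of 1 - w/c holomorphic near the level set. -/
theorem one_sub_div_mem_slitPlane (hc : ‖c‖ = 1) (hR : 1 < R) (hcR : c ∉ levelSet n c R 1)
    {v : ℂ} (hv : v ∈ levelSet n c R 1) : 1 - v / c ∈ Complex.slitPlane := by
  have hc0 : c ≠ 0 := by
    rintro rfl
    simp at hc
  by_contra h
  rw [Complex.mem_slitPlane_iff] at h
  push Not at h
  obtain ⟨hre, him⟩ := h
  set s : ℝ := 1 - (1 - v / c).re with hs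
  have hs1 : 1 ≤ s := by linarith
  have hvc : v = s * c := by
    have : v / c = s := by
      apply Complex.ext
      · simp [hs]
      · simpa using him
    rw [← this, div_mul_cancel₀ _ hc0]
  apply hcR
  have := smul_mem_levelSet_one hc hR hv (t := s⁻¹) (by positivity) (inv_le_one_of_one_le₀ hs1)
  rw [hvc, ← mul_assoc, ← Complex.ofReal_mul, inv_mul_cancel₀ (by positivity), Complex.ofReal_one,
    one_mul] at this
  exact this

theorem differentiable_iterate (k : ℕ) : Differentiable ℂ (unicriticalMap n c)^[k] := by
  refine Differentiable.iterate ?_ k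
  unfold unicriticalMap
  fun_prop

theorem norm_deriv (z : ℂ) : ‖deriv (unicriticalMap n c) z‖ = n * ‖z‖ ^ (n - 1) := by
  have : deriv (unicriticalMap n c) z = n * z ^ (n - 1) := by
    unfold unicriticalMap
    simp
  simp [this]

theorem norm_deriv_iterate_succ (k : ℕ) (z : ℂ) :
    ‖deriv (unicriticalMap n c)^[k + 1] z‖ =
      ‖deriv (unicriticalMap n c)^[k] (unicriticalMap n c z)‖ * (n * ‖z‖ ^ (n - 1)) := by
  have h : DifferentiableAt ℂ (unicriticalMap n c) z := differentiable_iterate 1 z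
  rw [Function.iterate_succ, deriv_comp _ (differentiable_iterate k _) h, norm_mul, norm_deriv]

/-- An inverse branch of the map on a neighbourhood of the first level set, selected by a
connected set of points. -/
theorem exists_inverse_branch (hc : ‖c‖ = 1) (hR : 1 < R) (hn : n ≠ 0)
    (hcR : c ∉ levelSet n c R 1) {C : Set ℂ} (hC : IsPreconnected C)
    (hCK : C ⊆ levelSet n c R 2) :
    ∃ g : ℂ → ℂ, (∀ w, unicriticalMap n c (g w) = w) ∧
      (∀ w ∈ levelSet n c R 1, DifferentiableAt ℂ g w) ∧
      ∀ y ∈ C, g (unicriticalMap n c y) = y := by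
  have hc0 : c ≠ 0 := by
    rintro rfl
    simp at hc
  have hslit : ∀ y ∈ C, 1 - unicriticalMap n c y / c ∈ Complex.slitPlane := fun y hy =>
    one_sub_div_mem_slitPlane hc hR hcR (hCK hy)
  set r : ℂ → ℂ := fun w => (1 - w / c) ^ ((n : ℂ)⁻¹) with hr
  have hrn : ∀ w, r w ^ n = 1 - w / c := fun w => Complex.cpow_nat_inv_pow _ hn
  have hrdiff : ∀ w, 1 - w / c ∈ Complex.slitPlane → DifferentiableAt ℂ r w := by
    intro w hw
    exact ((differentiableAt_const _).sub (differentiableAt_id.div_const c)).cpow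
      (differentiableAt_const _) hw
  have hr0 : ∀ y ∈ C, r (unicriticalMap n c y) ≠ 0 := by
    intro y hy h
    have := hrn (unicriticalMap n c y)
    rw [h, zero_pow hn] at this
    exact Complex.slitPlane_ne_zero (hslit y hy) this.symm
  -- `q` is continuous with values among the n-th roots of `-c`, hence constant on `C`; that
  -- constant selects the branch.
  set q : ℂ → ℂ := fun y => y / r (unicriticalMap n c y) with hq
  have hqc : ContinuousOn q C := by
    intro y hy
    refine ContinuousAt.continuousWithinAt ?_
    exact continuousAt_id.div
      (((hrdiff _ (hslit y hy)).continuousAt).comp (continuous_iterate 1).continuousAt) (hr0 y hy)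
  have hqn : ∀ y ∈ C, q y ^ n = -c := by
    intro y hy
    have h1 := hrn (unicriticalMap n c y)
    have h2 := Complex.slitPlane_ne_zero (hslit y hy)
    rw [hq]
    simp only [div_pow]
    rw [h1, div_eq_iff h2, unicriticalMap]
    field_simp
    ring
  have hfin : {ρ : ℂ | ρ ^ n = -c}.Finite := by
    refine (Polynomial.nthRoots n (-c)).toFinset.finite_toSet.subset fun ρ hρ => ?_
    simpa [Polynomial.mem_nthRoots (Nat.pos_of_ne_zero hn)] using hρ
  have hsub : (q '' C).Subsingleton := by
    have hsf : (q '' C).Finite := hfin.subset (by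
      rintro _ ⟨y, hy, rfl⟩
      exact hqn y hy)
    exact hsf.countable.isTotallyDisconnected (q '' C) subset_rfl (hC.image q hqc)
  have hρ : ∃ ρ : ℂ, ρ ^ n = -c ∧ ∀ y ∈ C, q y = ρ := by
    rcases C.eq_empty_or_nonempty with rfl | ⟨y₀, hy₀⟩
    · exact ⟨(-c) ^ ((n : ℂ)⁻¹), Complex.cpow_nat_inv_pow _ hn, by simp⟩
    · exact ⟨q y₀, hqn y₀ hy₀, fun y hy => hsub ⟨y, hy, rfl⟩ ⟨y₀, hy₀, rfl⟩⟩
  obtain ⟨ρ, hρn, hρ⟩ := hρ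
  refine ⟨fun w => ρ * r w, fun w => ?_, fun w hw => ?_, fun y hy => ?_⟩
  · rw [unicriticalMap, mul_pow, hrn, hρn]
    field_simp
    ring
  · exact (hrdiff w (one_sub_div_mem_slitPlane hc hR hcR hw)).const_mul ρ
  · rw [← hρ y hy]
    exact div_mul_cancel₀ _ (hr0 y hy)

/-- An inverse branch of the `k`-th iterate, selected by a connected subset of the filled Julia
set. -/
theorem exists_iterate_inverse_branch (hc : ‖c‖ = 1) (hR : 1 < R) (h3 : 3 ≤ R ^ (n - 1))
    (hn : n ≠ 0) (hcR : c ∉ levelSet n c R 1) (k : ℕ) {C : Set ℂ} (hC : IsPreconnected C)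
    (hCK : C ⊆ ⋂ k, levelSet n c R k) :
    ∃ G : ℂ → ℂ, (∀ w, (unicriticalMap n c)^[k] (G w) = w) ∧
      (∀ w ∈ levelSet n c R 1, DifferentiableAt ℂ G w) ∧
      ∀ y ∈ C, G ((unicriticalMap n c)^[k] y) = y := by
  induction k generalizing C with
  | zero => exact ⟨id, fun _ => rfl, fun _ _ => differentiableAt_id, fun _ _ => rfl⟩
  | succ k ih =>
    obtain ⟨g, hg1, hg2, hg3⟩ := exists_inverse_branch hc hR hn hcR hC
      (hCK.trans (Set.iInter_subset _ 2))
    obtain ⟨G, hG1, hG2, hG3⟩ := ih (C := unicriticalMap n c '' C)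
      (hC.image _ (continuous_iterate 1).continuousOn) (by
        rintro _ ⟨y, hy, rfl⟩
        exact Set.mem_iInter.2 fun j => Set.mem_iInter.1 (hCK hy) (j + 1))
    refine ⟨g ∘ G, fun w => ?_, fun w hw => ?_, fun y hy => ?_⟩
    · rw [Function.iterate_succ_apply, Function.comp_apply, hg1, hG1]
    · refine (hg2 _ ?_).comp w (hG2 w hw)
      refine levelSet_antitone hc hR h3 hn (Nat.le_add_left 1 k) ?_
      rw [mem_levelSet, Nat.add_comm, Function.iterate_add_apply, hG1]
      exact mem_levelSet.1 hw
    · rw [Function.iterate_succ_apply, Function.comp_apply, hG3 _ ⟨y, hy, rfl⟩, hg3 y hy]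

theorem isTotallyDisconnected_filledJuliaSet (hc : ‖c‖ = 1) (hR : 1 < R) (h3 : 3 ≤ R ^ (n - 1))
    (hn : n ≠ 0) (hcR : c ∉ levelSet n c R 1) {a : ℝ} (ha : 0 < a)
    (hexp : ∀ k, ∀ z ∈ levelSet n c R (k + 1), a * 2 ^ k ≤ ‖deriv (unicriticalMap n c)^[k] z‖) :
    IsTotallyDisconnected (filledJuliaSet (unicriticalMap n c)) := by
  rw [filledJuliaSet_eq hc hR h3 hn]
  intro C hCK hC x hx y hy
  -- A single branch `G` recovers all of `C` from its k-th image. The mean value inequality along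
  -- segments from 0 bounds its distance to `G 0`.
  have hbound : ∀ k : ℕ, ‖x - y‖ ≤ (2 * R / a) * (1 / 2) ^ k := by
    intro k
    obtain ⟨G, hG1, hG2, hG3⟩ := exists_iterate_inverse_branch hc hR h3 hn hcR k hC hCK
    have hderiv : ∀ w ∈ levelSet n c R 1, ‖deriv G w‖ ≤ (a * 2 ^ k)⁻¹ := by
      intro w hw
      have hlevel : G w ∈ levelSet n c R (k + 1) := by
        rw [mem_levelSet, Nat.add_comm, Function.iterate_add_apply, hG1]
        exact mem_levelSet.1 hw
      have h1 : deriv (unicriticalMap n c)^[k] (G w) * deriv G w = 1 := by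
        rw [← deriv_comp _ (differentiable_iterate k _) (hG2 w hw)]
        have : (unicriticalMap n c)^[k] ∘ G = id := funext hG1
        rw [this, deriv_id]
      have h2 : ‖deriv (unicriticalMap n c)^[k] (G w)‖ * ‖deriv G w‖ = 1 := by
        rw [← norm_mul, h1, norm_one]
      have h4 := hexp k _ hlevel
      rw [le_inv_comm₀ (by
        by_contra! h
        have : ‖deriv G w‖ = 0 := le_antisymm h (norm_nonneg _)
        simp [this] at h2) (by positivity)]
      rwa [← eq_inv_of_mul_eq_one_left h2]
    have hball : ∀ z ∈ C, ‖z - G 0‖ ≤ (a * 2 ^ k)⁻¹ * R := by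
      intro z hz
      set u := (unicriticalMap n c)^[k] z with hu
      have hu1 : u ∈ levelSet n c R 1 := by
        rw [mem_levelSet, hu, ← Function.iterate_add_apply]
        exact mem_levelSet.1 (Set.mem_iInter.1 (hCK hz) (1 + k))
      have hu0 : ‖u‖ ≤ R := mem_levelSet.1 (Set.mem_iInter.1 (hCK hz) k)
      have hseg : segment ℝ 0 u ⊆ levelSet n c R 1 := by
        intro w hw
        rw [segment_eq_image] at hw
        obtain ⟨t, ht, rfl⟩ := hw
        simpa using smul_mem_levelSet_one hc hR hu1 ht.1 ht.2
      have h := Convex.norm_image_sub_le_of_norm_deriv_le (𝕜 := ℂ) (f := G)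
        (fun w hw => hG2 w (hseg hw)) (fun w hw => hderiv w (hseg hw)) (convex_segment 0 u)
        (left_mem_segment ℝ 0 u) (right_mem_segment ℝ 0 u)
      rw [hG3 z hz, sub_zero] at h
      exact h.trans (by gcongr)
    calc ‖x - y‖ ≤ ‖x - G 0‖ + ‖y - G 0‖ := by
          simpa [dist_eq_norm] using dist_triangle_right x y (G 0)
      _ ≤ (a * 2 ^ k)⁻¹ * R + (a * 2 ^ k)⁻¹ * R := add_le_add (hball x hx) (hball y hy)
      _ = (2 * R / a) * (1 / 2) ^ k := by
          rw [one_div, inv_pow]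
          field_simp
          ring
  have hlim : Filter.Tendsto (fun k : ℕ => (2 * R / a) * (1 / 2 : ℝ) ^ k) Filter.atTop
      (nhds 0) := by
    simpa using (tendsto_pow_atTop_nhds_zero_of_lt_one (by norm_num : (0 : ℝ) ≤ 1 / 2)
      (by norm_num)).const_mul (2 * R / a)
  have h0 : ‖x - y‖ ≤ 0 := ge_of_tendsto' hlim hbound
  exact sub_eq_zero.1 (norm_le_zero_iff.1 h0)

theorem isClosed_filledJuliaSet (hc : ‖c‖ = 1) (hR : 1 < R) (h3 : 3 ≤ R ^ (n - 1)) (hn : n ≠ 0) :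
    IsClosed (filledJuliaSet (unicriticalMap n c)) := by
  rw [filledJuliaSet_eq hc hR h3 hn]
  exact isClosed_iInter isClosed_levelSet

/-! ### Expansion -/

/-- If `z ^ n` is small compared with `1 / n`, then the second iterate of `z` is close to the
second iterate of the critical point. -/
theorem norm_map_map_sub_le (hc : ‖c‖ = 1) {τ : ℝ} (hτ1 : τ ≤ 1) {z : ℂ}
    (hz : n * ‖z‖ ^ n ≤ τ) :
    ‖unicriticalMap n c (unicriticalMap n c z) - (c ^ n + c)‖ ≤ 2 * τ := by
  have hz0 : 0 ≤ n * ‖z‖ ^ n := by positivity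
  have h1 : unicriticalMap n c (unicriticalMap n c z) - (c ^ n + c) = (z ^ n + c) ^ n - c ^ n := by
    simp only [unicriticalMap]
    ring
  have h2 : (1 + ‖z ^ n‖) ^ n ≤ Real.exp τ := by
    calc (1 + ‖z ^ n‖) ^ n ≤ Real.exp ‖z ^ n‖ ^ n := by
          gcongr
          linarith [Real.add_one_le_exp ‖z ^ n‖]
      _ = Real.exp (n * ‖z‖ ^ n) := by rw [← Real.exp_nat_mul, norm_pow]
      _ ≤ Real.exp τ := Real.exp_le_exp.2 hz
  have h4 : |Real.exp τ - 1| ≤ 2 * |τ| :=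
    Real.abs_exp_sub_one_le (by rw [abs_of_nonneg (hz0.trans hz)]; exact hτ1)
  rw [abs_of_nonneg (hz0.trans hz)] at h4
  rw [h1]
  linarith [norm_add_pow_sub_pow_le (δ := z ^ n) hc n, le_abs_self (Real.exp τ - 1)]

/-- A step with `4 ≤ n * ‖z‖ ^ n` doubles the derivative. Otherwise the image of `z` has modulus at
least 1 - 4/n, and its large derivative makes two steps together gain a factor 4. The loss `τ / 4`
covers a weak final step. -/
theorem expansion (hc : ‖c‖ = 1) (hR : 1 < R) (hR2 : R ≤ 2) (h3 : 3 ≤ R ^ (n - 1)) (hn : n ≠ 0)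
    {τ : ℝ} (hτ0 : 0 < τ) (hτ1 : τ ≤ 1) (h4n : 4 ≤ n) {b : ℝ}
    (hb : b ≤ (1 + -4 / (n : ℝ)) ^ n) (hnb : 16 ≤ n * (τ * b))
    (hτ : ∀ z ∈ levelSet n c R 2, τ < n * ‖z‖ ^ n) (k : ℕ) :
    ∀ z ∈ levelSet n c R (k + 1), τ / 4 * 2 ^ k ≤ ‖deriv (unicriticalMap n c)^[k] z‖ := by
  have hanti := levelSet_antitone hc hR h3 hn
  have hfac : ∀ j, ∀ z ∈ levelSet n c R j, n * ‖z‖ ^ n / 2 ≤ n * ‖z‖ ^ (n - 1) := by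
    intro j z hz
    have hz0 : ‖z‖ ≤ 2 := (mem_levelSet.1 (hanti (Nat.zero_le j) hz)).trans hR2
    have h1 : ‖z‖ ^ n = ‖z‖ ^ (n - 1) * ‖z‖ := by
      rw [← pow_succ, Nat.sub_add_cancel (Nat.one_le_iff_ne_zero.2 hn)]
    have h2 : ‖z‖ ^ (n - 1) * ‖z‖ ≤ ‖z‖ ^ (n - 1) * 2 := by gcongr
    rw [h1, mul_div_assoc]
    gcongr
    linarith
  induction k using Nat.strong_induction_on with
  | _ k ih =>
  intro z hz
  match k, ih, hz with
  | 0, _, _ =>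
    simp only [Function.iterate_zero, deriv_id, norm_one, pow_zero]
    linarith
  | 1, _, hz =>
    have h1 := hτ z hz
    have h2 := hfac _ z hz
    rw [Function.iterate_one, norm_deriv]
    linarith
  | k + 2, ih, hz =>
    have hz2 : z ∈ levelSet n c R 2 := hanti (by omega) hz
    have hz' : unicriticalMap n c z ∈ levelSet n c R (k + 1 + 1) := hz
    have hz'' : unicriticalMap n c (unicriticalMap n c z) ∈ levelSet n c R (k + 1) := hz
    have hf := hfac _ z hz
    have hf' := hfac _ _ hz'
    rw [norm_deriv_iterate_succ]
    by_cases hbig : 4 ≤ n * ‖z‖ ^ n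
    · have h1 := ih (k + 1) (by omega) _ hz'
      calc τ / 4 * 2 ^ (k + 2) = τ / 4 * 2 ^ (k + 1) * 2 := by ring
        _ ≤ _ := by
          gcongr
          linarith
    · push Not at hbig
      have hn0 : (0 : ℝ) < n := by positivity
      have hn4 : (4 : ℝ) ≤ n := by exact_mod_cast h4n
      have h1 := ih k (by omega) _ hz''
      have h5 : 1 + -4 / (n : ℝ) ≤ ‖unicriticalMap n c z‖ := by
        have h6 : ‖c‖ - ‖z ^ n‖ ≤ ‖unicriticalMap n c z‖ := by
          have := norm_sub_norm_le c (-z ^ n)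
          simpa [unicriticalMap, add_comm] using this
        have h7 : ‖z‖ ^ n ≤ 4 / n := by
          rw [le_div_iff₀ hn0]
          linarith
        rw [hc, norm_pow] at h6
        rw [neg_div]
        linarith
      have h8 : 0 ≤ 1 + -4 / (n : ℝ) := by
        have : 4 / (n : ℝ) ≤ 1 := (div_le_one hn0).2 hn4
        rw [neg_div]
        linarith
      have h9 : b ≤ ‖unicriticalMap n c z‖ ^ n := hb.trans (by gcongr)
      have hp1 : τ / 2 ≤ n * ‖z‖ ^ (n - 1) := by linarith [hτ z hz2]
      have hp2 : n * b / 2 ≤ n * ‖unicriticalMap n c z‖ ^ (n - 1) := by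
        refine le_trans ?_ hf'
        gcongr
      rw [norm_deriv_iterate_succ, mul_assoc]
      have hprod : 4 ≤ n * ‖unicriticalMap n c z‖ ^ (n - 1) * (n * ‖z‖ ^ (n - 1)) := by
        calc (4 : ℝ) ≤ n * b / 2 * (τ / 2) := by linarith
          _ ≤ _ := by gcongr
      calc τ / 4 * 2 ^ (k + 2) = τ / 4 * 2 ^ k * 4 := by ring
        _ ≤ _ := by gcongr

end unicriticalMap

/-! ### Position of the critical orbit and conclusion -/

theorem norm_sq_exp_pow_add (θ : ℝ) (c : ℂ) (hc : c = Complex.exp (2 * Real.pi * Complex.I * θ))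
    (n : ℕ) :
    ‖c ^ n + c‖ ^ 2 = 2 + 2 * Real.cos (2 * Real.pi * θ * ((n : ℝ) - 1)) := by
  set φ : ℝ := 2 * Real.pi * θ * ((n : ℝ) - 1) with hφ
  have hc1 : ‖c‖ = 1 := by
    have : c = Complex.exp ((2 * Real.pi * θ : ℝ) * Complex.I) := by
      rw [hc]
      push_cast
      ring_nf
    rw [this, Complex.norm_exp_ofReal_mul_I]
  have h1 : c ^ n + c = c * (Complex.exp (φ * Complex.I) + 1) := by
    have : c ^ n = c * Complex.exp (φ * Complex.I) := by
      rw [hc, ← Complex.exp_nat_mul, ← Complex.exp_add, hφ]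
      push_cast
      ring_nf
    rw [this]
    ring
  rw [h1, norm_mul, hc1, one_mul, ← Complex.normSq_eq_norm_sq, Complex.normSq_apply]
  simp only [Complex.add_re, Complex.add_im, Complex.exp_ofReal_mul_I_re,
    Complex.exp_ofReal_mul_I_im, Complex.one_re, Complex.one_im]
  nlinarith [Real.sin_sq_add_cos_sq φ]

open unicriticalMap Filter in
theorem corollary3p2 (θ : ℝ) (c : ℂ) (hc : c = Complex.exp (2 * Real.pi * Complex.I * θ)) :
    ∀ ε : ℝ, 0 < ε → ∃ N : ℕ, 2 ≤ N ∧ ∀ n : ℕ, N ≤ n →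
      (Real.cos (2 * Real.pi * θ * ((n : ℝ) - 1)) < -1 / 2 - ε / 2 →
        IsConnected (filledJuliaSet (unicriticalMap n c))) ∧
      (-1 / 2 + ε / 2 < Real.cos (2 * Real.pi * θ * ((n : ℝ) - 1)) →
        IsTotallyDisconnected (filledJuliaSet (unicriticalMap n c)) ∧
        filledJuliaSet (unicriticalMap n c) = juliaSet (unicriticalMap n c)) := by
  intro ε hε
  have hc1 : ‖c‖ = 1 := by
    have : c = Complex.exp ((2 * Real.pi * θ : ℝ) * Complex.I) := by
      rw [hc]
      push_cast
      ring_nf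
    rw [this, Complex.norm_exp_ofReal_mul_I]
  obtain ⟨η, hη0, hη1, hηε⟩ : ∃ η : ℝ, 0 < η ∧ η ≤ 1 / 8 ∧ 8 * η ≤ ε :=
    ⟨min ε 1 / 8, by positivity, by linarith [min_le_right ε 1], by linarith [min_le_left ε 1]⟩
  have e1 : ∀ᶠ n : ℕ in atTop, 3 ≤ (1 + η) ^ (n - 1) :=
    ((tendsto_pow_atTop_atTop_of_one_lt (by linarith : 1 < 1 + η)).comp
      (tendsto_sub_atTop_nat 1)).eventually_ge_atTop 3
  have e2 : ∀ᶠ n : ℕ in atTop, n * (1 - 3 * η) ^ n ≤ η / 2 :=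
    (tendsto_self_mul_const_pow_of_lt_one (by linarith : 0 ≤ 1 - 3 * η)
      (by linarith)).eventually_le_const (by positivity)
  -- The limit is e⁻⁴, so e⁻⁵ leaves room.
  have e3 : ∀ᶠ n : ℕ in atTop, Real.exp (-5) ≤ (1 + -4 / (n : ℝ)) ^ n :=
    (Real.tendsto_one_add_div_pow_exp (-4)).eventually_const_le
      (Real.exp_lt_exp.2 (by norm_num))
  have e4 : ∀ᶠ n : ℕ in atTop, 16 ≤ n * (η / 2 * Real.exp (-5)) :=
    (tendsto_natCast_atTop_atTop.atTop_mul_const (by positivity)).eventually_ge_atTop 16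
  obtain ⟨N, hN⟩ := eventually_atTop.1
    (((e1.and e2).and (e3.and e4)).and (eventually_ge_atTop 4))
  refine ⟨max N 2, le_max_right _ _, fun n hn => ?_⟩
  obtain ⟨⟨⟨h3, hsmall⟩, hb, hnb⟩, h4n⟩ := hN n ((le_max_left _ _).trans hn)
  have hn0 : n ≠ 0 := by omega
  have hR : 1 < 1 + η := by linarith
  have hw := norm_sq_exp_pow_add θ c hc n
  constructor
  · intro hcos
    have hw1 : ‖c ^ n + c‖ ≤ 1 - 4 * η := by
      refine abs_le_of_sq_le_sq' ?_ (by linarith) |>.2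
      nlinarith
    have heven : ∀ k : ℕ, ‖(unicriticalMap n c)^[2 * k] 0‖ ≤ 1 - 3 * η := by
      intro k
      induction k with
      | zero =>
        simp only [mul_zero, Function.iterate_zero, id_eq, norm_zero]
        linarith
      | succ k ih =>
        have hz : n * ‖(unicriticalMap n c)^[2 * k] 0‖ ^ n ≤ η / 2 :=
          le_trans (by gcongr) hsmall
        have h1 := norm_map_map_sub_le hc1 (by linarith) hz
        rw [show 2 * (k + 1) = 2 * k + 1 + 1 by ring, Function.iterate_succ_apply',
          Function.iterate_succ_apply']
        have h2 := norm_le_norm_add_norm_sub' (unicriticalMap n c (unicriticalMap n c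
          ((unicriticalMap n c)^[2 * k] 0))) (c ^ n + c)
        linarith
    refine isConnected_filledJuliaSet hc1 hR h3 hn0 fun k => ?_
    -- Level sets decrease, so even iterates suffice.
    refine levelSet_antitone hc1 hR h3 hn0 (by omega : k ≤ 2 * k) ?_
    exact mem_levelSet.2 ((heven k).trans (by linarith))
  · intro hcos
    have hw1 : 1 + 2 * η < ‖c ^ n + c‖ := by
      refine lt_of_pow_lt_pow_left₀ 2 (norm_nonneg _) ?_
      nlinarith
    have hcR : c ∉ levelSet n c (1 + η) 1 := by
      rw [mem_levelSet, Function.iterate_one, unicriticalMap]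
      linarith
    -- Otherwise the second iterate is within η of `c ^ n + c`, hence outside radius 1 + η.
    have hτ : ∀ z ∈ levelSet n c (1 + η) 2, η / 2 < n * ‖z‖ ^ n := by
      intro z hz
      by_contra! h
      have h1 := norm_map_map_sub_le hc1 (by linarith) h
      have h2 : ‖unicriticalMap n c (unicriticalMap n c z)‖ ≤ 1 + η := mem_levelSet.1 hz
      have h4 := norm_le_norm_add_norm_sub (unicriticalMap n c (unicriticalMap n c z)) (c ^ n + c)
      linarith
    have htd : IsTotallyDisconnected (filledJuliaSet (unicriticalMap n c)) :=
      isTotallyDisconnected_filledJuliaSet hc1 hR h3 hn0 hcR (by positivity)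
        (expansion hc1 hR (by linarith) h3 hn0 (by positivity : 0 < η / 2) (by linarith) h4n
          hb hnb hτ)
    refine ⟨htd, ?_⟩
    have hint : interior (filledJuliaSet (unicriticalMap n c)) = ∅ := by
      by_contra hne
      obtain ⟨z, hz⟩ := Set.nonempty_iff_ne_empty.2 hne
      obtain ⟨r, hr, hball⟩ := Metric.isOpen_iff.1 isOpen_interior z hz
      have hsub := htd _ (hball.trans interior_subset) (convex_ball z r).isPreconnected
      have hmem : z + ((r / 2 : ℝ) : ℂ) ∈ Metric.ball z r := by
        rw [mem_ball_iff_norm, add_sub_cancel_left, Complex.norm_real,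
          Real.norm_of_nonneg (by positivity)]
        linarith
      have := hsub hmem (Metric.mem_ball_self hr)
      rw [add_eq_left, Complex.ofReal_eq_zero] at this
      linarith
    rw [juliaSet, (isClosed_filledJuliaSet hc1 hR h3 hn0).frontier_eq, hint, Set.sdiff_empty]
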